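/- For $n\ge 1$ and $k \ge 1$ the Kneser graph $KG(n,k)$ has the $k$-subsets of $\{1,\dots,n\}$ as its vertices, two of them being adjacent if and only if they are disjoint. A vertex cut of a connected graph $G$ is a set $S$ of vertices such that $G-S$ is disconnected; it is a super vertex cut if moreover $G-S$ has no isolated vertex. The super-connectivity $\kappa_1(G)$ is the minimum size of a super vertex cut of $G$. Theorem. Let $n\ge 7$. Then $KG(n,3)$ has a super vertex cut, and its super-connectivity is \[ \kappa_1(KG(n,3))=\begin{cases} 2\left(\binom{n-3}{3}-1\right) & \text{if } 7\le n\le 8,\\[2pt] 2\left(\binom{n-3}{3}-1\right)-\binom{n-6}{3} & \text{if } n\ge 9.\end{cases} \] Moreover, a set $S$ of vertices of $KG(n,3)$ is a super vertex cut of size $\kappa_1(KG(n,3))$ if and only if it is the neighbourhood of an edge, that is, if and only if there is an edge $uv$ of $KG(n,3)$ such that $S=(N(u)\cup N(v))\setminus\{u,v\}$, where $N(x)$ is the set of neighbours of $x$. (This is the case $k=3$ of the Boruzanli–Gauci conjecture: for $n\ge 2k+1$, $\kappa_1(KG(n,k))$ is $2\left(\binom{n-k}{k}-1\right)$ if $2k+1\le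 n<3k$ and $2\left(\binom{n-k}{k}-1\right)-\binom{n-2k}{k}$ if $n\ge 3k$.) -/

import Mathlib

/-- The Kneser graph `KG(n, k)`: the vertices are the `k`-subsets of an `n`-set, and two distinct
vertices are adjacent when they are disjoint. (For `k ≥ 1` disjoint vertices are automatically
distinct.) -/
def kneserGraph (n k : ℕ) : SimpleGraph {s : Finset (Fin n) // s.card = k} where
  Adj s t := s ≠ t ∧ Disjoint s.1 t.1
  symm := ⟨fun _ _ h => ⟨h.1.symm, h.2.symm⟩⟩
  loopless := ⟨fun _ h => h.1 rfl⟩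

namespace SimpleGraph

variable {V : Type*}

/-- A vertex cut of a connected graph `G`: a set of vertices whose deletion makes `G` disconnected.
`¬ Preconnected` says that some two remaining vertices are joined by no walk in `G - S`, so the graph
without vertices does not count as disconnected. -/
def IsVertexCut (G : SimpleGraph V) (S : Finset V) : Prop :=
  G.Connected ∧ ¬ (G.induce ((S : Set V)ᶜ)).Preconnected

/-- A super vertex cut: a vertex cut `S` such that `G - S` has no isolated vertex. -/
def IsSuperVertexCut (G : SimpleGraph V) (S : Finset V) : Prop :=
  G.IsVertexCut S ∧ ∀ v, ∃ w, (G.induce ((S : Set V)ᶜ)).Adj v w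

/-- The super-connectivity `κ₁` of `G`: the minimum size of a super vertex cut
(with the junk value `0` if there is no super vertex cut). -/
noncomputable def superConnectivity (G : SimpleGraph V) : ℕ :=
  sInf {m | ∃ S : Finset V, G.IsSuperVertexCut S ∧ S.card = m}

/-- The neighbourhood of the pair `{u, v}`: the vertices other than `u`, `v` that are adjacent to
`u` or to `v`. -/
def pairNeighborSet (G : SimpleGraph V) (u v : V) : Set V :=
  (G.neighborSet u ∪ G.neighborSet v) \ {u, v}

end SimpleGraph

/-! Deleting a super vertex cut leaves a component `A` and a nonempty rest `B` with no edge between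
them, so every triple in `A` meets every triple in `B`. As no vertex is isolated, `A` contains
disjoint triples `U`, `V`, and `B` contains disjoint triples `X`, `Y`. Everything rests on the bound
|A| + |B| ≤ 9n - 34, attained only if `A = {U, V}` or `B = {X, Y}`. Since C(n,3) - (9n - 34) is the
size of the neighbourhood of an edge, this yields both the value of κ₁ and the minimum cuts.

For the bound, the other members of `A` meet both `X` and `Y`, and those of `B` meet both `U` and
`V`; there are 9n - 38 candidates on each side. A perfect matching of the candidates by disjointness
gives |A| + |B| - 4 ≤ 9n - 38, because at most one triple of a matched pair can occur. If the bound
is attained, exactly one of each pair occurs; a second matching joins the pairs on w points into a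
single cycle, which forces the same side to be chosen throughout
(`card_add_card_le_of_disjointCycle`).

Up to symmetry `U`, `V`, `X`, `Y` form one of three configurations, covering six, seven or eight
points. For each, explicit cycles on w points are given. Any further points are handled uniformly: a
triple through an outside point z is matched with one through σ z, where σ is a permutation without
fixed points. Such a σ exists unless there is exactly one outside point, whence two values of w for
each configuration. -/

/-! ### Cyclic arrangements on at most nine points -/

/-- Sets of points below `w` are encoded by the binary digits of natural numbers. For two pairs
`U`, `V` and `X`, `Y` of triples, this is a cyclic arrangement `s 0, t 0, s 1, t 1, …` of triples in
which consecutive members are disjoint. The `s i` run over the triples other than `U`, `V` that meet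
`X` and `Y`, and the `t i` over the triples other than `X`, `Y` that meet `U` and `V`. The pairs of
points in `X × Y` and in `U × V` are listed as `a` and `b` in such a way that `a j` and `b j` are
disjoint. -/
structure DisjointCycle (w N U V X Y : ℕ) where
  s : Fin (N + 1) → ℕ
  t : Fin (N + 1) → ℕ
  a : Fin 9 → ℕ
  b : Fin 9 → ℕ
  s_and_t : ∀ i, s i &&& t i = 0
  t_and_s : ∀ i, t i &&& s (i + 1) = 0
  a_and_b : ∀ j, a j &&& b j = 0
  exists_s_eq : ∀ p q r : Fin w, p < q → q < r →
    (2 ^ p.1 ||| 2 ^ q.1 ||| 2 ^ r.1) &&& X ≠ 0 → (2 ^ p.1 ||| 2 ^ q.1 ||| 2 ^ r.1) &&& Y ≠ 0 →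
    2 ^ p.1 ||| 2 ^ q.1 ||| 2 ^ r.1 ≠ U → 2 ^ p.1 ||| 2 ^ q.1 ||| 2 ^ r.1 ≠ V →
    ∃ i, s i = 2 ^ p.1 ||| 2 ^ q.1 ||| 2 ^ r.1
  exists_t_eq : ∀ p q r : Fin w, p < q → q < r →
    (2 ^ p.1 ||| 2 ^ q.1 ||| 2 ^ r.1) &&& U ≠ 0 → (2 ^ p.1 ||| 2 ^ q.1 ||| 2 ^ r.1) &&& V ≠ 0 →
    2 ^ p.1 ||| 2 ^ q.1 ||| 2 ^ r.1 ≠ X → 2 ^ p.1 ||| 2 ^ q.1 ||| 2 ^ r.1 ≠ Y →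
    ∃ i, t i = 2 ^ p.1 ||| 2 ^ q.1 ||| 2 ^ r.1
  exists_a_eq : ∀ p q : Fin w, X.testBit p → Y.testBit q → ∃ j, a j = 2 ^ p.1 ||| 2 ^ q.1
  exists_b_eq : ∀ p q : Fin w, U.testBit p → V.testBit q → ∃ j, b j = 2 ^ p.1 ||| 2 ^ q.1
  -- These two conditions extend the equality case from the cycle to triples with a point outside
  -- the w points.
  exists_t_and_a : ∀ j, ∃ i, t i &&& a j = 0
  exists_s_and_b : ∀ j, ∃ i, s i &&& b j = 0
  -- Of the w points, 9(w - 6) + 18 triples meet both of two disjoint triples. Leaving out two gives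
  -- 9w - 38 = N + 1.
  card_eq : N + 39 = 9 * w

/-- A cyclic arrangement for triples covering six of 7 points. -/
def disjointCycleSixInSeven : DisjointCycle 7 24 7 56 13 50 where
  s :=
    ![11, 26, 88, 25, 21, 81, 97, 41, 35, 67, 19, 49, 52, 38, 70, 22, 28, 84, 100, 37, 44, 104,
    42, 14, 74]
  t :=
    ![100, 37, 38, 98, 42, 14, 22, 84, 28, 44, 76, 74, 73, 25, 41, 97, 35, 11, 26, 82, 19, 21,
    81, 49, 52]
  a := ![3, 17, 33, 6, 20, 36, 10, 24, 40]
  b := ![12, 10, 18, 9, 33, 17, 36, 34, 20]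
  s_and_t := by decide +kernel
  t_and_s := by decide +kernel
  a_and_b := by decide +kernel
  exists_s_eq := by decide +kernel
  exists_t_eq := by decide +kernel
  exists_a_eq := by decide +kernel
  exists_b_eq := by decide +kernel
  exists_t_and_a := by decide +kernel
  exists_s_and_b := by decide +kernel
  card_eq := rfl

/-- A cyclic arrangement for triples covering six of 8 points. -/
def disjointCycleSixInEight : DisjointCycle 8 33 7 56 13 50 where
  s :=
    ![11, 131, 67, 35, 42, 168, 41, 37, 104, 44, 74, 26, 88, 28, 25, 152, 21, 81, 19, 97, 49,
    145, 161, 100, 52, 84, 164, 148, 70, 22, 134, 38, 14, 138]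
  t :=
    ![52, 28, 148, 84, 21, 22, 82, 146, 19, 145, 37, 164, 35, 162, 38, 98, 42, 44, 140, 14, 76,
    74, 26, 138, 137, 11, 73, 41, 161, 97, 25, 81, 49, 100]
  a := ![3, 17, 33, 6, 20, 36, 10, 24, 40]
  b := ![12, 10, 18, 9, 33, 17, 36, 34, 20]
  s_and_t := by decide +kernel
  t_and_s := by decide +kernel
  a_and_b := by decide +kernel
  exists_s_eq := by decide +kernel
  exists_t_eq := by decide +kernel
  exists_a_eq := by decide +kernel
  exists_b_eq := by decide +kernel
  exists_t_and_a := by decide +kernel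
  exists_s_and_b := by decide +kernel
  card_eq := rfl

/-- A cyclic arrangement for triples covering seven of 7 points. -/
def disjointCycleSevenInSeven : DisjointCycle 7 24 7 56 13 82 where
  s :=
    ![11, 35, 49, 52, 100, 69, 73, 104, 76, 14, 42, 74, 26, 22, 38, 70, 84, 21, 28, 88, 25, 19,
    81, 97, 67]
  t :=
    ![84, 76, 74, 11, 26, 50, 22, 19, 49, 81, 21, 37, 97, 73, 25, 41, 42, 98, 35, 38, 100, 44,
    14, 28, 52]
  a := ![3, 17, 65, 6, 20, 68, 10, 24, 72]
  b := ![12, 10, 18, 9, 33, 17, 20, 34, 36]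
  s_and_t := by decide +kernel
  t_and_s := by decide +kernel
  a_and_b := by decide +kernel
  exists_s_eq := by decide +kernel
  exists_t_eq := by decide +kernel
  exists_a_eq := by decide +kernel
  exists_b_eq := by decide +kernel
  exists_t_and_a := by decide +kernel
  exists_s_and_b := by decide +kernel
  card_eq := rfl

/-- A cyclic arrangement for triples covering seven of 8 points. -/
def disjointCycleSevenInEight : DisjointCycle 8 33 7 56 13 82 where
  s :=
    ![11, 42, 38, 52, 84, 22, 134, 70, 14, 138, 104, 69, 76, 148, 28, 26, 88, 74, 35, 19, 67, 97,
    81, 49, 21, 73, 200, 100, 196, 145, 193, 25, 152, 131]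
  t :=
    ![84, 81, 73, 11, 137, 41, 25, 145, 49, 21, 146, 50, 35, 97, 161, 37, 164, 148, 76, 140, 28,
    14, 138, 74, 162, 22, 19, 26, 42, 44, 38, 98, 100, 52]
  a := ![3, 17, 65, 6, 20, 68, 10, 24, 72]
  b := ![12, 10, 18, 9, 33, 17, 20, 34, 36]
  s_and_t := by decide +kernel
  t_and_s := by decide +kernel
  a_and_b := by decide +kernel
  exists_s_eq := by decide +kernel
  exists_t_eq := by decide +kernel
  exists_a_eq := by decide +kernel
  exists_b_eq := by decide +kernel
  exists_t_and_a := by decide +kernel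
  exists_s_and_b := by decide +kernel
  card_eq := rfl

/-- A cyclic arrangement for triples covering eight of 8 points. -/
def disjointCycleEightInEight : DisjointCycle 8 33 7 56 73 146 where
  s :=
    ![11, 42, 14, 168, 133, 49, 21, 28, 26, 88, 25, 140, 196, 193, 161, 137, 35, 19, 152, 84,
    145, 81, 112, 224, 70, 98, 67, 131, 208, 82, 194, 200, 138, 74]
  t :=
    ![148, 145, 81, 82, 74, 138, 162, 97, 161, 164, 98, 19, 50, 26, 22, 84, 76, 100, 35, 42, 38,
    14, 11, 25, 137, 140, 28, 44, 41, 13, 49, 21, 37, 52]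
  a := ![3, 17, 129, 10, 24, 136, 66, 80, 192]
  b := ![12, 10, 18, 17, 33, 34, 9, 36, 20]
  s_and_t := by decide +kernel
  t_and_s := by decide +kernel
  a_and_b := by decide +kernel
  exists_s_eq := by decide +kernel
  exists_t_eq := by decide +kernel
  exists_a_eq := by decide +kernel
  exists_b_eq := by decide +kernel
  exists_t_and_a := by decide +kernel
  exists_s_and_b := by decide +kernel
  card_eq := rfl

/-- A cyclic arrangement for triples covering eight of 9 points. -/
def disjointCycleEightInNine : DisjointCycle 9 42 7 56 73 146 where
  s :=
    ![11, 42, 14, 70, 138, 74, 266, 208, 81, 273, 88, 194, 336, 84, 82, 322, 112, 21, 49, 35, 19,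
    67, 25, 28, 26, 280, 152, 259, 131, 98, 448, 392, 168, 200, 140, 137, 193, 161, 133, 196,
    224, 145, 385]
  t :=
    ![148, 81, 145, 273, 21, 49, 37, 42, 44, 164, 289, 41, 11, 265, 13, 137, 138, 74, 76, 140,
    268, 292, 162, 97, 161, 98, 100, 84, 28, 25, 35, 19, 274, 50, 290, 276, 22, 82, 266, 26, 14,
    38, 52]
  a := ![3, 17, 129, 10, 24, 136, 66, 80, 192]
  b := ![12, 10, 18, 17, 33, 34, 9, 36, 20]
  s_and_t := by decide +kernel
  t_and_s := by decide +kernel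
  a_and_b := by decide +kernel
  exists_s_eq := by decide +kernel
  exists_t_eq := by decide +kernel
  exists_a_eq := by decide +kernel
  exists_b_eq := by decide +kernel
  exists_t_and_a := by decide +kernel
  exists_s_and_b := by decide +kernel
  card_eq := rfl

/-! ### Cross-intersecting families of triples -/

section CrossIntersecting

open Finset

/-- Indices with `s i ∈ A` and those with `t i ∈ B` form disjoint sets, at least as large as `A` and
`B`. If the bound is attained, these sets exhaust `ι`. Injectivity is not needed, only that all
members are listed. -/
theorem card_add_card_le_of_forall_notMem {ι β : Type*} [Fintype ι] [DecidableEq β] (s t : ι → β)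
    {A B : Finset β} (hA : ∀ e ∈ A, ∃ i, s i = e) (hB : ∀ e ∈ B, ∃ i, t i = e)
    (h : ∀ i, s i ∈ A → t i ∉ B) :
    #A + #B ≤ Fintype.card ι ∧ (Fintype.card ι ≤ #A + #B → ∀ i, s i ∈ A ∨ t i ∈ B) := by
  classical
  have hA' : #A ≤ #{i | s i ∈ A} := by
    refine (card_le_card fun e he => ?_).trans (card_image_le (f := s))
    obtain ⟨i, rfl⟩ := hA e he
    exact mem_image_of_mem _ (by simpa using he)
  have hB' : #B ≤ #{i | t i ∈ B} := by
    refine (card_le_card fun e he => ?_).trans (card_image_le (f := t))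
    obtain ⟨i, rfl⟩ := hB e he
    exact mem_image_of_mem _ (by simpa using he)
  have hd : Disjoint ({i | s i ∈ A} : Finset ι) ({i | t i ∈ B} : Finset ι) := by
    rw [disjoint_left]
    intro i hi hi'
    exact h i (by simpa using hi) (by simpa using hi')
  have hu := card_union_of_disjoint hd
  have hle := card_le_univ (({i | s i ∈ A} : Finset ι) ∪ ({i | t i ∈ B} : Finset ι))
  refine ⟨by omega, fun hc i => ?_⟩
  have huniv := (card_eq_iff_eq_univ _).1 (le_antisymm hle (by omega))
  have := mem_univ i
  rw [← huniv] at this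
  simpa using this

open Fin.CommRing in
theorem Fin.forall_of_succ_imp {N : ℕ} {P : Fin (N + 1) → Prop} (h : ∀ i, P (i + 1) → P i)
    {i : Fin (N + 1)} (hi : P i) (j : Fin (N + 1)) : P j := by
  have key : ∀ (k : ℕ) (j : Fin (N + 1)), P (j + (k : Fin (N + 1))) → P j := by
    intro k
    induction k with
    | zero => intro j hj; simpa using hj
    | succ k ih =>
      intro j hj
      refine ih j (h _ ?_)
      rwa [add_assoc, ← Nat.cast_succ]
  apply key (i - j).val
  rwa [Fin.cast_val_eq_self, add_sub_cancel]

theorem exists_perm_forall_ne {β : Type*} [Fintype β] (h : Fintype.card β ≠ 1) :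
    ∃ σ : Equiv.Perm β, ∀ x, σ x ≠ x := by
  obtain ⟨e⟩ : Nonempty (β ≃ Fin (Fintype.card β)) := ⟨Fintype.equivFin β⟩
  generalize Fintype.card β = k at h e
  match k, h, e with
  | 0, _, e => exact ⟨1, fun x => (e x).elim0⟩
  | k + 2, _, e =>
    refine ⟨(e.trans (Equiv.addRight 1)).trans e.symm, fun x hx => ?_⟩
    have := congrArg e hx
    simp at this

variable {α : Type*} {w : ℕ}

/-- The image under `f` of the set of positions of the nonzero binary digits of `k`. -/
def digitSet (f : Fin w ↪ α) (k : ℕ) : Finset α :=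
  (univ.filter fun i : Fin w => k.testBit i).map f

theorem mem_digitSet {f : Fin w ↪ α} {k : ℕ} {z : α} :
    z ∈ digitSet f k ↔ ∃ i : Fin w, k.testBit i ∧ f i = z := by
  simp [digitSet]

theorem disjoint_digitSet {f : Fin w ↪ α} {k l : ℕ} (h : k &&& l = 0) :
    Disjoint (digitSet f k) (digitSet f l) := by
  rw [disjoint_left]
  intro z hz hz'
  obtain ⟨i, hi, rfl⟩ := mem_digitSet.1 hz
  obtain ⟨j, hj, hji⟩ := mem_digitSet.1 hz'
  obtain rfl := f.injective hji
  have := Nat.testBit_and k l j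
  simp [h, hi, hj] at this

theorem List.Nodup.exists_embedding_eq_getElem [Fintype α] {l : List α} (hl : l.Nodup) {w : ℕ}
    (hlw : l.length ≤ w) (hw : w ≤ Fintype.card α) :
    ∃ f : Fin w ↪ α, ∀ i (h : i < l.length), f ⟨i, h.trans_le hlw⟩ = l[i] := by
  obtain ⟨f, hf⟩ := Fin.Embedding.restrictSurjective_of_le_natCard hlw
    (hw.trans_eq Nat.card_eq_fintype_card.symm) ⟨l.get, hl.injective_get⟩
  exact ⟨f, fun i h => DFunLike.congr_fun hf ⟨i, h⟩⟩

variable [DecidableEq α]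

theorem exists_eq_triple_of_mem {s : Finset α} (hs : #s = 3) {a b : α} (ha : a ∈ s) (hb : b ∈ s)
    (hab : a ≠ b) : ∃ c, c ≠ a ∧ c ≠ b ∧ s = {a, b, c} := by
  have hb' : b ∈ s.erase a := mem_erase.2 ⟨hab.symm, hb⟩
  obtain ⟨c, hc⟩ : ∃ c, (s.erase a).erase b = {c} := by
    rw [← card_eq_one, card_erase_of_mem hb', card_erase_of_mem ha, hs]
  have hc' : c ∈ (s.erase a).erase b := by simp [hc]
  simp only [mem_erase] at hc'
  refine ⟨c, hc'.2.1, hc'.1, ?_⟩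
  rw [← insert_erase ha, ← insert_erase hb', hc]

theorem digitSet_two_pow_or (f : Fin w ↪ α) (p q : Fin w) :
    digitSet f (2 ^ p.1 ||| 2 ^ q.1) = {f p, f q} := by
  ext z
  simp only [mem_digitSet, Nat.testBit_or, Nat.testBit_two_pow, Bool.or_eq_true, decide_eq_true_eq,
    mem_insert, mem_singleton, Fin.val_inj]
  grind

theorem digitSet_two_pow_or_or (f : Fin w ↪ α) (p q r : Fin w) :
    digitSet f (2 ^ p.1 ||| 2 ^ q.1 ||| 2 ^ r.1) = {f p, f q, f r} := by
  ext z
  simp only [mem_digitSet, Nat.testBit_or, Nat.testBit_two_pow, Bool.or_eq_true, decide_eq_true_eq,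
    mem_insert, mem_singleton, Fin.val_inj]
  grind

theorem exists_lt_lt_of_card_eq_three {β : Type*} [LinearOrder β] {s : Finset β} (hs : #s = 3) :
    ∃ p q r, p < q ∧ q < r ∧ s = {p, q, r} := by
  refine ⟨s.orderEmbOfFin hs 0, s.orderEmbOfFin hs 1, s.orderEmbOfFin hs 2, by simp, by simp, ?_⟩
  apply coe_injective
  rw [← range_orderEmbOfFin s hs]
  ext z
  constructor
  · rintro ⟨i, rfl⟩
    fin_cases i <;> simp
  · simp only [coe_insert, coe_singleton, Set.mem_insert_iff, Set.mem_singleton_iff]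
    rintro (rfl | rfl | rfl) <;> exact ⟨_, rfl⟩

theorem exists_digitSet_eq {f : Fin w ↪ α} {N P Q R S : ℕ} {s : Fin (N + 1) → ℕ}
    (h : ∀ p q r : Fin w, p < q → q < r →
      (2 ^ p.1 ||| 2 ^ q.1 ||| 2 ^ r.1) &&& P ≠ 0 → (2 ^ p.1 ||| 2 ^ q.1 ||| 2 ^ r.1) &&& Q ≠ 0 →
      2 ^ p.1 ||| 2 ^ q.1 ||| 2 ^ r.1 ≠ R → 2 ^ p.1 ||| 2 ^ q.1 ||| 2 ^ r.1 ≠ S →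
      ∃ i, s i = 2 ^ p.1 ||| 2 ^ q.1 ||| 2 ^ r.1)
    {e : Finset α} (he : #e = 3) (hf : ∀ z ∈ e, z ∈ Set.range f)
    (hP : ¬ Disjoint e (digitSet f P)) (hQ : ¬ Disjoint e (digitSet f Q))
    (hR : e ≠ digitSet f R) (hS : e ≠ digitSet f S) : ∃ i, digitSet f (s i) = e := by
  obtain ⟨e, rfl⟩ : ∃ e' : Finset (Fin w), e'.map f = e :=
    ⟨e.preimage f f.injective.injOn, by
      ext z
      simp only [mem_map, mem_preimage]
      constructor
      · rintro ⟨a, ha, rfl⟩; exact ha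
      · intro hz
        obtain ⟨a, rfl⟩ := hf z hz
        exact ⟨a, hz, rfl⟩⟩
  rw [card_map] at he
  obtain ⟨p, q, r, hpq, hqr, rfl⟩ := exists_lt_lt_of_card_eq_three he
  have hm : ({p, q, r} : Finset (Fin w)).map f = digitSet f (2 ^ p.1 ||| 2 ^ q.1 ||| 2 ^ r.1) := by
    rw [digitSet_two_pow_or_or]; simp
  rw [hm] at hP hQ hR hS ⊢
  obtain ⟨i, hi⟩ := h p q r hpq hqr (fun h => hP (disjoint_digitSet h))
    (fun h => hQ (disjoint_digitSet h)) (fun h => hR (congrArg _ h)) (fun h => hS (congrArg _ h))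
  exact ⟨i, congrArg _ hi⟩

/-- One point of `e` lies outside the range, so the other two must be one from each of the two
disjoint sets that `e` meets. -/
theorem exists_insert_digitSet_eq {f : Fin w ↪ α} {P Q : ℕ} {a : Fin 9 → ℕ}
    (h : ∀ p q : Fin w, P.testBit p → Q.testBit q → ∃ j, a j = 2 ^ p.1 ||| 2 ^ q.1)
    (hPQ : Disjoint (digitSet f P) (digitSet f Q)) {e : Finset α} (he : #e = 3)
    (hP : ¬ Disjoint e (digitSet f P)) (hQ : ¬ Disjoint e (digitSet f Q)) {z : α} (hz : z ∈ e)
    (hf : z ∉ Set.range f) : ∃ j, insert z (digitSet f (a j)) = e := by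
  obtain ⟨p', hpe, hp'⟩ := not_disjoint_iff.1 hP
  obtain ⟨q', hqe, hq'⟩ := not_disjoint_iff.1 hQ
  have hpq : p' ≠ q' := fun h => disjoint_left.1 hPQ hp' (h ▸ hq')
  obtain ⟨p, hp, rfl⟩ := mem_digitSet.1 hp'
  obtain ⟨q, hq, rfl⟩ := mem_digitSet.1 hq'
  obtain ⟨j, hj⟩ := h p q hp hq
  refine ⟨j, ?_⟩
  rw [hj, digitSet_two_pow_or]
  have hzp : z ≠ f p := fun h => hf ⟨p, h.symm⟩
  have hzq : z ≠ f q := fun h => hf ⟨q, h.symm⟩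
  apply eq_of_subset_of_card_le
  · simp [insert_subset_iff, hz, hpe, hqe]
  · rw [he, card_eq_three.2 ⟨z, f p, f q, hzp, hzq, hpq, rfl⟩]

theorem card_add_card_le_of_disjointCycle [Fintype α] {N u v x y : ℕ}
    (c : DisjointCycle w N u v x y) (f : Fin w ↪ α) (hα : Fintype.card α ≠ w + 1)
    {A B : Finset (Finset α)} (hA : ∀ e ∈ A, #e = 3) (hB : ∀ e ∈ B, #e = 3)
    (hAB : ∀ a ∈ A, ∀ b ∈ B, ¬ Disjoint a b)
    (hu : digitSet f u ∈ A) (hv : digitSet f v ∈ A) (hx : digitSet f x ∈ B) (hy : digitSet f y ∈ B)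
    (huv : Disjoint (digitSet f u) (digitSet f v)) (hxy : Disjoint (digitSet f x) (digitSet f y)) :
    #A + #B + 34 ≤ 9 * Fintype.card α ∧ (9 * Fintype.card α ≤ #A + #B + 34 →
      A = {digitSet f u, digitSet f v} ∨ B = {digitSet f x, digitSet f y}) := by
  classical
  have ne_of_disjoint : ∀ {p q : Finset α}, #p = 3 → Disjoint p q → p ≠ q := by
    rintro p _ hp hd rfl
    simp at hd
    simp [hd] at hp
  have hne := ne_of_disjoint (hA _ hu) huv
  have hne' := ne_of_disjoint (hB _ hx) hxy
  set U := digitSet f u with hU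
  set V := digitSet f v with hV
  set X := digitSet f x with hX
  set Y := digitSet f y with hY
  have hUV : ({U, V} : Finset (Finset α)) ⊆ A := by simp [insert_subset_iff, hu, hv]
  have hXY : ({X, Y} : Finset (Finset α)) ⊆ B := by simp [insert_subset_iff, hx, hy]
  have hcA := card_sdiff_add_card_eq_card hUV
  have hcB := card_sdiff_add_card_eq_card hXY
  rw [card_pair hne] at hcA
  rw [card_pair hne'] at hcB
  have hO : Fintype.card {z // z ∉ Set.range f} + w = Fintype.card α := by
    have h1 : Fintype.card (Set.range f) = w := by
      rw [Set.card_range_of_injective f.injective, Fintype.card_fin]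
    have h2 := Fintype.card_subtype_compl (fun z => z ∈ Set.range f)
    have h3 := Fintype.card_subtype_le (fun z => z ∈ Set.range f)
    change Fintype.card {z // z ∈ Set.range f} = w at h1
    omega
  -- `hα` says that the number of outside points is not 1.
  obtain ⟨σ, hσ⟩ := exists_perm_forall_ne (β := {z // z ∉ Set.range f}) (by omega)
  let s : Fin (N + 1) ⊕ {z // z ∉ Set.range f} × Fin 9 → Finset α :=
    Sum.elim (fun i => digitSet f (c.s i)) (fun p => insert p.1.1 (digitSet f (c.a p.2)))
  let t : Fin (N + 1) ⊕ {z // z ∉ Set.range f} × Fin 9 → Finset α :=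
    Sum.elim (fun i => digitSet f (c.t i)) (fun p => insert (σ p.1).1 (digitSet f (c.b p.2)))
  have notMem : ∀ (z : {z // z ∉ Set.range f}) k, z.1 ∉ digitSet f k := by
    intro z k hz
    obtain ⟨i, -, hi⟩ := mem_digitSet.1 hz
    exact z.2 ⟨i, hi⟩
  have hst : ∀ i, Disjoint (s i) (t i) := by
    rintro (i | ⟨z, j⟩)
    · exact disjoint_digitSet (c.s_and_t i)
    · have h1 := notMem z (c.b j)
      have h2 := notMem (σ z) (c.a j)
      have h3 : (σ z).1 ≠ z.1 := fun h => hσ z (Subtype.ext h)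
      simp [s, t, h1, h2, h3, disjoint_digitSet (c.a_and_b j)]
  have hs : ∀ e ∈ A \ {U, V}, ∃ i, s i = e := by
    intro e he
    simp only [mem_sdiff, mem_insert, mem_singleton, not_or] at he
    by_cases hf : ∀ z ∈ e, z ∈ Set.range f
    · obtain ⟨i, hi⟩ := exists_digitSet_eq c.exists_s_eq (hA e he.1) hf (hAB e he.1 _ hx)
        (hAB e he.1 _ hy) he.2.1 he.2.2
      exact ⟨Sum.inl i, hi⟩
    · push Not at hf
      obtain ⟨z, hz, hzf⟩ := hf
      obtain ⟨j, hj⟩ := exists_insert_digitSet_eq c.exists_a_eq hxy (hA e he.1)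
        (hAB e he.1 _ hx) (hAB e he.1 _ hy) hz hzf
      exact ⟨Sum.inr (⟨z, hzf⟩, j), hj⟩
  have ht : ∀ e ∈ B \ {X, Y}, ∃ i, t i = e := by
    intro e he
    simp only [mem_sdiff, mem_insert, mem_singleton, not_or] at he
    have hdu : ¬ Disjoint e U := fun h => hAB _ hu e he.1 h.symm
    have hdv : ¬ Disjoint e V := fun h => hAB _ hv e he.1 h.symm
    by_cases hf : ∀ z ∈ e, z ∈ Set.range f
    · obtain ⟨i, hi⟩ := exists_digitSet_eq c.exists_t_eq (hB e he.1) hf hdu hdv he.2.1 he.2.2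
      exact ⟨Sum.inl i, hi⟩
    · push Not at hf
      obtain ⟨z, hz, hzf⟩ := hf
      obtain ⟨j, hj⟩ := exists_insert_digitSet_eq c.exists_b_eq huv (hB e he.1) hdu hdv hz hzf
      exact ⟨Sum.inr (σ.symm ⟨z, hzf⟩, j), by simpa [t] using hj⟩
  obtain ⟨hle, heq⟩ := card_add_card_le_of_forall_notMem s t hs ht
    (fun i hi hi' => hAB _ (mem_sdiff.1 hi).1 _ (mem_sdiff.1 hi').1 (hst i))
  have hN := c.card_eq
  rw [Fintype.card_sum, Fintype.card_prod, Fintype.card_fin, Fintype.card_fin] at hle heq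
  -- The index type has N + 1 + 9(|α| - w) = 9|α| - 38 elements, and `U`, `V`, `X`, `Y` add 4.
  refine ⟨by omega, fun h => ?_⟩
  have hor := heq (by omega)
  by_cases hex : ∃ i, digitSet f (c.s i) ∈ A \ {U, V}
  · right
    obtain ⟨i, hi⟩ := hex
    have hall : ∀ j, digitSet f (c.s j) ∈ A \ {U, V} := by
      -- Going backwards round the cycle: if `s (j + 1)` occurs, then `t j` does not, hence `s j`
      -- does.
      refine Fin.forall_of_succ_imp (fun j hj => (hor (Sum.inl j)).resolve_right fun hj' => ?_) hi
      exact hAB _ (mem_sdiff.1 hj).1 _ (mem_sdiff.1 hj').1 (disjoint_digitSet (c.t_and_s j)).symm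
    refine (subset_antisymm hXY ?_).symm
    rw [← sdiff_eq_empty_iff_subset, eq_empty_iff_forall_notMem]
    intro e he
    obtain ⟨i | ⟨z, j⟩, rfl⟩ := ht e he
    · exact hAB _ (mem_sdiff.1 (hall i)).1 _ (mem_sdiff.1 he).1 (hst (Sum.inl i))
    -- A triple with an outside point is disjoint from some `s i`, and all of these lie in `A`.
    · obtain ⟨i, hi⟩ := c.exists_s_and_b j
      refine hAB _ (mem_sdiff.1 (hall i)).1 _ (mem_sdiff.1 he).1 ?_
      simp [t, notMem, disjoint_digitSet hi]
  · left
    push Not at hex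
    have hall : ∀ j, digitSet f (c.t j) ∈ B \ {X, Y} :=
      fun j => (hor (Sum.inl j)).resolve_left (hex j)
    refine (subset_antisymm hUV ?_).symm
    rw [← sdiff_eq_empty_iff_subset, eq_empty_iff_forall_notMem]
    intro e he
    obtain ⟨i | ⟨z, j⟩, rfl⟩ := hs e he
    · exact hAB _ (mem_sdiff.1 he).1 _ (mem_sdiff.1 (hall i)).1 (hst (Sum.inl i))
    · obtain ⟨i, hi⟩ := c.exists_t_and_a j
      refine hAB _ (mem_sdiff.1 he).1 _ (mem_sdiff.1 (hall i)).1 ?_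
      simp [s, notMem, (disjoint_digitSet hi).symm]

variable [Fintype α]

/-- The bound for cross-intersecting families of triples containing disjoint pairs `U`, `V` and
`X`, `Y` respectively, with the extremal case. -/
def PairBound (U V X Y : Finset α) : Prop :=
  ∀ A B : Finset (Finset α), (∀ e ∈ A, #e = 3) → (∀ e ∈ B, #e = 3) →
    (∀ a ∈ A, ∀ b ∈ B, ¬ Disjoint a b) → U ∈ A → V ∈ A → X ∈ B → Y ∈ B →
    #A + #B + 34 ≤ 9 * Fintype.card α ∧
      (9 * Fintype.card α ≤ #A + #B + 34 → A = {U, V} ∨ B = {X, Y})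

theorem PairBound.swap_left {U V X Y : Finset α} (h : PairBound U V X Y) : PairBound V U X Y := by
  intro A B hA hB hAB hV hU hX hY
  rw [pair_comm]
  exact h A B hA hB hAB hU hV hX hY

theorem PairBound.swap_right {U V X Y : Finset α} (h : PairBound U V X Y) : PairBound U V Y X := by
  intro A B hA hB hAB hU hV hY hX
  rw [pair_comm Y]
  exact h A B hA hB hAB hU hV hX hY

/-- The points of `l` receive the labels 0, 1, …; arbitrary further points receive the remaining
labels below `w`. -/
theorem DisjointCycle.pairBound {w N x y : ℕ} (c : DisjointCycle w N 7 56 x y) {l : List α}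
    (hl : l.Nodup) (hlw : l.length ≤ w) (hw : w ≤ Fintype.card α) (hne : Fintype.card α ≠ w + 1)
    {i j k i' j' k' : ℕ} (hx : x = 2 ^ i ||| 2 ^ j ||| 2 ^ k)
    (hy : y = 2 ^ i' ||| 2 ^ j' ||| 2 ^ k') (h5 : 5 < l.length) (hi : i < l.length)
    (hj : j < l.length) (hk : k < l.length) (hi' : i' < l.length) (hj' : j' < l.length)
    (hk' : k' < l.length) (hUV : Disjoint {l[0], l[1], l[2]} ({l[3], l[4], l[5]} : Finset α))
    (hXY : Disjoint {l[i], l[j], l[k]} ({l[i'], l[j'], l[k']} : Finset α)) :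
    PairBound {l[0], l[1], l[2]} {l[3], l[4], l[5]} {l[i], l[j], l[k]} {l[i'], l[j'], l[k']} := by
  obtain ⟨f, hf⟩ := hl.exists_embedding_eq_getElem hlw hw
  have key : ∀ p q r (hp : p < l.length) (hq : q < l.length) (hr : r < l.length),
      {l[p], l[q], l[r]} = digitSet f (2 ^ p ||| 2 ^ q ||| 2 ^ r) := by
    intro p q r hp hq hr
    rw [← hf p hp, ← hf q hq, ← hf r hr]
    exact (digitSet_two_pow_or_or f _ _ _).symm
  have h7 : 2 ^ 0 ||| 2 ^ 1 ||| 2 ^ 2 = 7 := rfl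
  have h56 : 2 ^ 3 ||| 2 ^ 4 ||| 2 ^ 5 = 56 := rfl
  rw [key 0 1 2, key 3 4 5, h7, h56] at hUV ⊢
  rw [key, key, ← hx, ← hy] at hXY ⊢
  intro A B hA hB hAB hU hV hX hY
  exact card_add_card_le_of_disjointCycle c f hne hA hB hAB hU hV hX hY hUV hXY

theorem pairBound_of_nodup_six (hα : 7 ≤ Fintype.card α) {a b e c d g : α}
    (h : [a, b, e, c, d, g].Nodup) : PairBound {a, b, e} {c, d, g} {a, c, e} {b, d, g} := by
  have hUV : Disjoint {a, b, e} ({c, d, g} : Finset α) := by simp at h; simp; grind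
  have hXY : Disjoint {a, c, e} ({b, d, g} : Finset α) := by simp at h; simp; grind
  by_cases h8 : Fintype.card α = 8
  · exact disjointCycleSixInEight.pairBound h (by simp) (by omega) (by omega)
      (i := 0) (j := 3) (k := 2) (i' := 1) (j' := 4) (k' := 5) rfl rfl
      (by simp) (by simp) (by simp) (by simp) (by simp) (by simp) (by simp) hUV hXY
  · exact disjointCycleSixInSeven.pairBound h (by simp) (by omega) (by omega)
      (i := 0) (j := 3) (k := 2) (i' := 1) (j' := 4) (k' := 5) rfl rfl
      (by simp) (by simp) (by simp) (by simp) (by simp) (by simp) (by simp) hUV hXY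

theorem pairBound_of_nodup_seven {a b e c d g i : α}
    (h : [a, b, e, c, d, g, i].Nodup) : PairBound {a, b, e} {c, d, g} {a, c, e} {b, d, i} := by
  have hUV : Disjoint {a, b, e} ({c, d, g} : Finset α) := by simp at h; simp; grind
  have hXY : Disjoint {a, c, e} ({b, d, i} : Finset α) := by simp at h; simp; grind
  have hc : 7 ≤ Fintype.card α := by simpa using h.length_le_card
  by_cases h8 : Fintype.card α = 8
  · exact disjointCycleSevenInEight.pairBound h (by simp) (by omega) (by omega)
      (i := 0) (j := 3) (k := 2) (i' := 1) (j' := 4) (k' := 6) rfl rfl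
      (by simp) (by simp) (by simp) (by simp) (by simp) (by simp) (by simp) hUV hXY
  · exact disjointCycleSevenInSeven.pairBound h (by simp) (by omega) (by omega)
      (i := 0) (j := 3) (k := 2) (i' := 1) (j' := 4) (k' := 6) rfl rfl
      (by simp) (by simp) (by simp) (by simp) (by simp) (by simp) (by simp) hUV hXY

theorem pairBound_of_nodup_eight {a b e c d g i j : α}
    (h : [a, b, e, c, d, g, i, j].Nodup) : PairBound {a, b, e} {c, d, g} {a, c, i} {b, d, j} := by
  have hUV : Disjoint {a, b, e} ({c, d, g} : Finset α) := by simp at h; simp; grind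
  have hXY : Disjoint {a, c, i} ({b, d, j} : Finset α) := by simp at h; simp; grind
  have hc : 8 ≤ Fintype.card α := by simpa using h.length_le_card
  by_cases h9 : Fintype.card α = 9
  · exact disjointCycleEightInNine.pairBound h (by simp) (by omega) (by omega)
      (i := 0) (j := 3) (k := 6) (i' := 1) (j' := 4) (k' := 7) rfl rfl
      (by simp) (by simp) (by simp) (by simp) (by simp) (by simp) (by simp) hUV hXY
  · exact disjointCycleEightInEight.pairBound h (by simp) (by omega) (by omega)
      (i := 0) (j := 3) (k := 6) (i' := 1) (j' := 4) (k' := 7) rfl rfl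
      (by simp) (by simp) (by simp) (by simp) (by simp) (by simp) (by simp) hUV hXY

/-- Points chosen from the four intersections are distinct, and each triple has one further point:
`e`, `g`, `i`, `j` for `U`, `V`, `X`, `Y`. Only coincidences of `e` or `g` with `i` or `j` are
possible; exchanging the pairs or their members reduces these to the three configurations. -/
theorem pairBound (hα : 7 ≤ Fintype.card α) {U V X Y : Finset α} (hU : #U = 3) (hV : #V = 3)
    (hX : #X = 3) (hY : #Y = 3) (hUV : Disjoint U V) (hXY : Disjoint X Y)
    (hUX : ¬ Disjoint U X) (hUY : ¬ Disjoint U Y) (hVX : ¬ Disjoint V X) (hVY : ¬ Disjoint V Y) :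
    PairBound U V X Y := by
  obtain ⟨a, haU, haX⟩ := not_disjoint_iff.1 hUX
  obtain ⟨b, hbU, hbY⟩ := not_disjoint_iff.1 hUY
  obtain ⟨c, hcV, hcX⟩ := not_disjoint_iff.1 hVX
  obtain ⟨d, hdV, hdY⟩ := not_disjoint_iff.1 hVY
  obtain ⟨e, hea, heb, rfl⟩ :=
    exists_eq_triple_of_mem hU haU hbU (disjoint_iff_ne.1 hXY a haX b hbY)
  obtain ⟨g, hgc, hgd, rfl⟩ :=
    exists_eq_triple_of_mem hV hcV hdV (disjoint_iff_ne.1 hXY c hcX d hdY)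
  obtain ⟨i, hia, hic, rfl⟩ :=
    exists_eq_triple_of_mem hX haX hcX (disjoint_iff_ne.1 hUV a haU c hcV)
  obtain ⟨j, hjb, hjd, rfl⟩ :=
    exists_eq_triple_of_mem hY hbY hdY (disjoint_iff_ne.1 hUV b hbU d hdV)
  simp only [disjoint_insert_left, disjoint_singleton_left, mem_insert, mem_singleton,
    not_or] at hUV hXY
  by_cases hei : e = i
  · subst hei
    by_cases hgj : g = j
    · subst hgj
      exact pairBound_of_nodup_six hα (by simp; grind)
    · exact pairBound_of_nodup_seven (by simp; grind)
  by_cases hej : e = j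
  · subst hej
    by_cases hgi : g = i
    · subst hgi
      have := pairBound_of_nodup_six hα (a := b) (b := a) (e := e) (c := d) (d := c) (g := g)
        (by simp; grind)
      rw [insert_comm b a, insert_comm d c] at this
      exact this.swap_right
    · have := pairBound_of_nodup_seven (a := b) (b := a) (e := e) (c := d) (d := c) (g := g)
        (i := i) (by simp; grind)
      rw [insert_comm b a, insert_comm d c] at this
      exact this.swap_right
  by_cases hgi : g = i
  · subst hgi
    have := pairBound_of_nodup_seven (a := c) (b := d) (e := g) (c := a) (d := b) (g := e)
      (i := j) (by simp; grind)
    rw [insert_comm c a, insert_comm d b] at this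
    exact this.swap_left
  by_cases hgj : g = j
  · subst hgj
    have := pairBound_of_nodup_seven (a := d) (b := c) (e := g) (c := b) (d := a) (g := e)
      (i := i) (by simp; grind)
    rw [insert_comm c a, insert_comm d b, insert_comm d c, insert_comm b a] at this
    exact this.swap_left.swap_right
  exact pairBound_of_nodup_eight (by simp; grind)

end CrossIntersecting

/-! ### Cuts of the Kneser graph -/

section KneserGraph

open Finset

variable {n : ℕ}

theorem kneserGraph_three_adj {s t : {s : Finset (Fin n) // s.card = 3}} :
    (kneserGraph n 3).Adj s t ↔ Disjoint s.1 t.1 := by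
  refine ⟨fun h => h.2, fun h => ⟨?_, h⟩⟩
  rintro rfl
  have := s.2
  rw [(disjoint_self_iff_empty _).1 h] at this
  simp at this

theorem exists_kneserGraph_three_adj (hn : 7 ≤ n) (u : {s : Finset (Fin n) // s.card = 3}) :
    ∃ v, (kneserGraph n 3).Adj u v := by
  obtain ⟨v, hv, hc⟩ := exists_subset_card_eq (s := u.1ᶜ) (n := 3) (by
    rw [card_compl, Fintype.card_fin, u.2]; omega)
  exact ⟨⟨v, hc⟩, kneserGraph_three_adj.2 (disjoint_left.2 fun z hz hz' => mem_compl.1 (hv hz') hz)⟩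

theorem exists_kneserGraph_three_edge (hn : 7 ≤ n) : ∃ u v, (kneserGraph n 3).Adj u v := by
  obtain ⟨u, -, hc⟩ := exists_subset_card_eq (s := (univ : Finset (Fin n))) (n := 3) (by
    rw [card_univ, Fintype.card_fin]; omega)
  exact ⟨⟨u, hc⟩, exists_kneserGraph_three_adj hn _⟩

theorem card_triples : Fintype.card {s : Finset (Fin n) // s.card = 3} = n.choose 3 := by
  simp

theorem card_filter_disjoint (u : Finset (Fin n)) :
    #{s : {s : Finset (Fin n) // s.card = 3} | Disjoint u s.1} = (n - #u).choose 3 := by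
  have h : ({s | Disjoint u s.1} : Finset {s : Finset (Fin n) // s.card = 3}).map (.subtype _) =
      powersetCard 3 uᶜ := by
    ext s
    simp [mem_powersetCard, subset_compl_iff_disjoint_left]
  rw [← card_map, h, card_powersetCard, card_compl, Fintype.card_fin]

/-- The first part identifies C(n,3) - (9n - 34) with the size of the neighbourhood of an edge; the
second shows that this size is positive, which gives connectedness. -/
theorem choose_three_identity (hn : 7 ≤ n) :
    n.choose 3 + (n - 6).choose 3 + 36 = 2 * (n - 3).choose 3 + 9 * n ∧
      9 * n < n.choose 3 + 34 := by
  obtain ⟨m, rfl⟩ := Nat.exists_eq_add_of_le' hn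
  rw [show m + 7 - 6 = m + 1 by omega, show m + 7 - 3 = m + 4 by omega]
  simp only [Nat.choose_succ_succ', Nat.choose_zero_right, Nat.choose_one_right]
  simp
  omega

theorem card_pairNeighborSet {u v : {s : Finset (Fin n) // s.card = 3}}
    (h : (kneserGraph n 3).Adj u v) :
    ((kneserGraph n 3).pairNeighborSet u v).ncard + (n - 6).choose 3 + 2
      = 2 * (n - 3).choose 3 := by
  classical
  have hd := kneserGraph_three_adj.1 h
  have hset : (kneserGraph n 3).pairNeighborSet u v =
      ↑((({s | Disjoint u.1 s.1} : Finset {s : Finset (Fin n) // s.card = 3}) ∪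
        ({s | Disjoint v.1 s.1} : Finset {s : Finset (Fin n) // s.card = 3})) \ {u, v}) := by
    ext s
    simp [SimpleGraph.pairNeighborSet, kneserGraph_three_adj]
  have hsub : ({u, v} : Finset {s : Finset (Fin n) // s.card = 3}) ⊆
      (({s | Disjoint u.1 s.1} : Finset {s : Finset (Fin n) // s.card = 3}) ∪
        ({s | Disjoint v.1 s.1} : Finset {s : Finset (Fin n) // s.card = 3})) := by
    simp [insert_subset_iff, hd, hd.symm]
  have h1 := card_sdiff_add_card_eq_card hsub
  have h2 := card_union_add_card_inter
    ({s | Disjoint u.1 s.1} : Finset {s : Finset (Fin n) // s.card = 3})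
    ({s | Disjoint v.1 s.1} : Finset {s : Finset (Fin n) // s.card = 3})
  rw [← filter_and] at h2
  simp only [← disjoint_union_left] at h2
  rw [card_filter_disjoint, card_filter_disjoint, card_filter_disjoint,
    card_union_of_disjoint hd, u.2, v.2] at h2
  rw [card_pair h.ne] at h1
  rw [hset, Set.ncard_coe_finset]
  simp only [Nat.reduceAdd] at h2
  omega

theorem card_add_card_le_of_forall_not_disjoint (hn : 7 ≤ n)
    {A B : Finset {s : Finset (Fin n) // s.card = 3}}
    (hAB : ∀ a ∈ A, ∀ b ∈ B, ¬ Disjoint a.1 b.1) {u v x y : {s : Finset (Fin n) // s.card = 3}}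
    (hu : u ∈ A) (hv : v ∈ A) (hx : x ∈ B) (hy : y ∈ B) (huv : Disjoint u.1 v.1)
    (hxy : Disjoint x.1 y.1) :
    #A + #B + 34 ≤ 9 * n ∧ (9 * n ≤ #A + #B + 34 → A = {u, v} ∨ B = {x, y}) := by
  have := pairBound (by simpa using hn) u.2 v.2 x.2 y.2 huv hxy (hAB u hu x hx) (hAB u hu y hy)
    (hAB v hv x hx) (hAB v hv y hy) (A.map (.subtype _)) (B.map (.subtype _))
    (by simp +contextual) (by simp +contextual) (by
      simp only [mem_map, Function.Embedding.subtype_apply]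
      rintro _ ⟨a, ha, rfl⟩ _ ⟨b, hb, rfl⟩
      exact hAB a ha b hb)
    (mem_map_of_mem _ hu) (mem_map_of_mem _ hv) (mem_map_of_mem _ hx) (mem_map_of_mem _ hy)
  rw [card_map, card_map, Fintype.card_fin] at this
  refine ⟨this.1, fun h => (this.2 h).imp (fun h => ?_) fun h => ?_⟩
  · apply map_injective (.subtype _)
    simpa using h
  · apply map_injective (.subtype _)
    simpa using h

theorem le_card_of_not_preconnected (hn : 7 ≤ n)
    {S : Finset {s : Finset (Fin n) // s.card = 3}}
    (hS : ¬ ((kneserGraph n 3).induce ((S : Set {s : Finset (Fin n) // s.card = 3})ᶜ)).Preconnected)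
    (hiso : ∀ v, ∃ w,
      ((kneserGraph n 3).induce ((S : Set {s : Finset (Fin n) // s.card = 3})ᶜ)).Adj v w) :
    n.choose 3 + 34 ≤ #S + 9 * n ∧ (#S + 9 * n ≤ n.choose 3 + 34 →
      ∃ u v, (kneserGraph n 3).Adj u v ∧
        (kneserGraph n 3).pairNeighborSet u v ⊆ (S : Set {s : Finset (Fin n) // s.card = 3})) := by
  classical
  simp only [SimpleGraph.Preconnected, not_forall] at hS
  obtain ⟨p, q, hpq⟩ := hS
  set H := (kneserGraph n 3).induce ((S : Set {s : Finset (Fin n) // s.card = 3})ᶜ) with hH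
  obtain ⟨v, hpv⟩ := hiso p
  obtain ⟨y, hqy⟩ := hiso q
  -- `A` is the component of `p` in the remaining graph, and `B` collects all other components.
  let A : Finset {s : Finset (Fin n) // s.card = 3} := {a | ∃ h : a ∉ S, H.Reachable p ⟨a, h⟩}
  let B : Finset {s : Finset (Fin n) // s.card = 3} := {a | ∃ h : a ∉ S, ¬ H.Reachable p ⟨a, h⟩}
  have hcard : #S + (#A + #B) = n.choose 3 := by
    have hABd : Disjoint A B := by
      simp only [A, B, disjoint_filter]
      rintro a - ⟨h, ha⟩ ⟨_, ha'⟩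
      exact ha' ha
    have hABc : A ∪ B = Sᶜ := by
      ext a
      simp only [A, B, mem_union, mem_filter, mem_univ, true_and, mem_compl]
      by_cases h : a ∈ S <;> simp [h, em]
    rw [← card_union_of_disjoint hABd, hABc, card_add_card_compl, card_triples]
  have hA : ∀ a : ((S : Set {s : Finset (Fin n) // s.card = 3})ᶜ : Set _),
      H.Reachable p a → a.1 ∈ A := fun a ha => by simpa [A] using ⟨a.2, ha⟩
  have hB : ∀ a : ((S : Set {s : Finset (Fin n) // s.card = 3})ᶜ : Set _),
      ¬ H.Reachable p a → a.1 ∈ B := fun a ha => by simpa [B] using ⟨a.2, ha⟩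
  have hAB : ∀ a ∈ A, ∀ b ∈ B, ¬ Disjoint a.1 b.1 := by
    simp only [A, B, mem_filter, mem_univ, true_and]
    rintro a ⟨ha, hpa⟩ b ⟨hb, hpb⟩ hd
    have hadj : H.Adj ⟨a, ha⟩ ⟨b, hb⟩ := kneserGraph_three_adj.2 hd
    exact hpb (hpa.trans hadj.reachable)
  have hqy' : ¬ H.Reachable p y := fun h => hpq (h.trans hqy.symm.reachable)
  obtain ⟨hle, heq⟩ := card_add_card_le_of_forall_not_disjoint hn hAB (hA p (.refl _))
    (hA v hpv.reachable) (hB q hpq) (hB y hqy') (kneserGraph_three_adj.1 hpv)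
    (kneserGraph_three_adj.1 hqy)
  refine ⟨by omega, fun h => ?_⟩
  have hmem : ∀ a, a ∉ S → a ∈ A ∨ a ∈ B := fun a ha => by
    by_cases hr : H.Reachable p ⟨a, ha⟩
    · exact .inl (hA ⟨a, ha⟩ hr)
    · exact .inr (hB ⟨a, ha⟩ hr)
  rcases heq (by omega) with hc | hc
  -- Since `A = {p, v}`, a remaining neighbour of `p` or `v` other than these would lie in `B` and
  -- be disjoint from a member of `A`.
  · refine ⟨p, v, hpv, ?_⟩
    rintro a ⟨had, hne⟩
    by_contra ha
    rcases hmem a ha with h' | h'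
    · rw [hc] at h'
      exact hne (by simpa using h')
    · rcases had with had | had
      · exact hAB _ (hA p (.refl _)) a h' (kneserGraph_three_adj.1 had)
      · exact hAB _ (hA v hpv.reachable) a h' (kneserGraph_three_adj.1 had)
  · refine ⟨q, y, hqy, ?_⟩
    rintro a ⟨had, hne⟩
    by_contra ha
    rcases hmem a ha with h' | h'
    · rcases had with had | had
      · exact hAB a h' _ (hB q hpq) (kneserGraph_three_adj.1 had).symm
      · exact hAB a h' _ (hB y hqy') (kneserGraph_three_adj.1 had).symm
    · rw [hc] at h'
      exact hne (by simpa using h')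

theorem kneserGraph_three_connected (hn : 7 ≤ n) : (kneserGraph n 3).Connected := by
  obtain ⟨u, -⟩ := exists_kneserGraph_three_edge hn
  refine (SimpleGraph.connected_iff _).2 ⟨?_, ⟨u⟩⟩
  -- Were the graph disconnected, the empty set would satisfy the hypotheses of the lower bound on
  -- cuts, which is positive.
  by_contra hc
  have := (le_card_of_not_preconnected hn (S := ∅) (fun h => hc fun a b => ?_) fun v => ?_).1
  · have := (choose_three_identity hn).2
    simp at *
    omega
  · exact (h ⟨a, by simp⟩ ⟨b, by simp⟩).map (SimpleGraph.Embedding.induce _).toHom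
  · obtain ⟨w, hw⟩ := exists_kneserGraph_three_adj hn v.1
    exact ⟨⟨w, by simp⟩, hw⟩

theorem isSuperVertexCut_of_eq_pairNeighborSet (hn : 7 ≤ n)
    {u v : {s : Finset (Fin n) // s.card = 3}} (huv : (kneserGraph n 3).Adj u v)
    {S : Finset {s : Finset (Fin n) // s.card = 3}}
    (hS : (S : Set {s : Finset (Fin n) // s.card = 3}) =
      (kneserGraph n 3).pairNeighborSet u v) : (kneserGraph n 3).IsSuperVertexCut S := by
  classical
  have hmem : ∀ a, a ∈ S ↔
      ((kneserGraph n 3).Adj u a ∨ (kneserGraph n 3).Adj v a) ∧ a ≠ u ∧ a ≠ v := by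
    intro a
    rw [← mem_coe, hS]
    simp [SimpleGraph.pairNeighborSet]
  have hu : u ∉ S := fun h => ((hmem u).1 h).2.1 rfl
  have hv : v ∉ S := fun h => ((hmem v).1 h).2.2 rfl
  refine ⟨⟨kneserGraph_three_connected hn, fun hp => ?_⟩, fun a => ?_⟩
  -- All other neighbours of `u` and `v` are deleted, so a walk ending in `{u, v}` never leaves it.
  · have hsub : ∀ a : ((S : Set {s : Finset (Fin n) // s.card = 3})ᶜ : Set _),
        a.1 = u ∨ a.1 = v := by
      intro a
      obtain ⟨W⟩ := hp a ⟨u, hu⟩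
      have key : ∀ {a b} (W : ((kneserGraph n 3).induce
          ((S : Set {s : Finset (Fin n) // s.card = 3})ᶜ)).Walk a b),
          b.1 = u ∨ b.1 = v → a.1 = u ∨ a.1 = v := by
        intro a b W
        induction W with
        | nil => exact id
        | @cons a b c hab _ ih =>
          intro hc
          by_contra ha
          have hab' : (kneserGraph n 3).Adj a.1 b.1 := hab
          refine a.2 ((hmem a.1).2 ⟨?_, not_or.1 ha⟩)
          rcases ih hc with hb | hb
          · exact .inl (hb ▸ hab'.symm)
          · exact .inr (hb ▸ hab'.symm)
      exact key W (.inl rfl)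
    have hc : #Sᶜ ≤ #{u, v} := card_le_card fun a ha => by
      simpa using hsub ⟨a, by simpa using ha⟩
    have h1 := card_add_card_compl S
    have h2 := card_pairNeighborSet huv
    rw [← hS, Set.ncard_coe_finset] at h2
    rw [card_triples] at h1
    rw [card_pair huv.ne] at hc
    have h3 := (choose_three_identity hn).1
    -- At most two vertices would remain, whereas 9n - 34 > 2 do.
    omega
  · obtain ⟨a, ha⟩ := a
    by_cases hau : a = u
    · subst hau
      exact ⟨⟨v, hv⟩, huv⟩
    by_cases hav : a = v
    · subst hav
      exact ⟨⟨u, hu⟩, huv.symm⟩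
    -- A neighbour of `a` outside `S` is a triple disjoint from `a` that meets both `u` and `v`: a
    -- point of each outside `a`, and any third point.
    have key : ∀ b : {s : Finset (Fin n) // s.card = 3}, a ≠ b → ∃ z ∈ b.1, z ∉ a.1 := by
      intro b hb
      by_contra! hsub
      exact hb (Subtype.ext (eq_of_subset_of_card_le hsub (by rw [a.2, b.2])).symm)
    obtain ⟨p, hpu, hpa⟩ := key u hau
    obtain ⟨q, hqv, hqa⟩ := key v hav
    have hpq : p ≠ q := disjoint_iff_ne.1 (kneserGraph_three_adj.1 huv) p hpu q hqv
    obtain ⟨r, hr⟩ : ∃ r, r ∉ a.1 ∪ {p, q} := by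
      by_contra! hall
      have h1 := card_le_card (fun r _ => hall r : univ ⊆ a.1 ∪ {p, q})
      have h2 := card_union_le a.1 {p, q}
      rw [card_univ, Fintype.card_fin] at h1
      rw [a.2, card_pair hpq] at h2
      omega
    simp only [mem_union, mem_insert, mem_singleton, not_or] at hr
    refine ⟨⟨⟨{p, q, r}, card_eq_three.2 ⟨p, q, r, hpq, Ne.symm hr.2.1, Ne.symm hr.2.2, rfl⟩⟩, ?_⟩,
      kneserGraph_three_adj.2 ?_⟩
    · intro h
      rcases ((hmem _).1 h).1 with h' | h'
      · exact disjoint_left.1 (kneserGraph_three_adj.1 h') hpu (by simp)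
      · exact disjoint_left.1 (kneserGraph_three_adj.1 h') hqv (by simp)
    · simp [hpa, hqa, hr.1]

end KneserGraph

/-! ### The super-connectivity and the minimum cuts -/

theorem theorem2p1 (n : ℕ) (hn : 7 ≤ n) :
    (∃ S, (kneserGraph n 3).IsSuperVertexCut S) ∧
    (n ≤ 8 → ((kneserGraph n 3).superConnectivity : ℤ) =
      2 * (((n - 3).choose 3 : ℤ) - 1)) ∧
    (9 ≤ n → ((kneserGraph n 3).superConnectivity : ℤ) =
      2 * (((n - 3).choose 3 : ℤ) - 1) - ((n - 6).choose 3 : ℤ)) ∧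
    (∀ S, ((kneserGraph n 3).IsSuperVertexCut S ∧
        S.card = (kneserGraph n 3).superConnectivity) ↔
      ∃ u v, (kneserGraph n 3).Adj u v ∧
        (S : Set {s : Finset (Fin n) // s.card = 3}) = (kneserGraph n 3).pairNeighborSet u v) := by
  have hid := (choose_three_identity hn).1
  have hpair : ∀ {u v} {S : Finset {s : Finset (Fin n) // s.card = 3}},
      (kneserGraph n 3).Adj u v → (S : Set {s : Finset (Fin n) // s.card = 3}) =
        (kneserGraph n 3).pairNeighborSet u v → S.card + 9 * n = n.choose 3 + 34 := by
    intro u v S h hS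
    have := card_pairNeighborSet h
    rw [← hS, Set.ncard_coe_finset] at this
    omega
  obtain ⟨u, v, huv⟩ := exists_kneserGraph_three_edge hn
  obtain ⟨S₀, hS₀⟩ := ((kneserGraph n 3).pairNeighborSet u v).toFinite.exists_finset_coe
  have hcut := isSuperVertexCut_of_eq_pairNeighborSet hn huv hS₀
  have hκ : (kneserGraph n 3).superConnectivity = S₀.card := by
    apply le_antisymm
    · exact Nat.sInf_le ⟨S₀, hcut, rfl⟩
    · refine le_csInf ⟨_, S₀, hcut, rfl⟩ ?_
      rintro _ ⟨S, hS, rfl⟩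
      have h1 := (le_card_of_not_preconnected hn hS.1.2 hS.2).1
      have h2 := hpair huv hS₀
      omega
  have hS₀c := hpair huv hS₀
  refine ⟨⟨S₀, hcut⟩, fun h8 => ?_, fun h9 => ?_, fun S => ⟨?_, ?_⟩⟩
  · have h6 : (n - 6).choose 3 = 0 := Nat.choose_eq_zero_of_lt (by omega)
    omega
  · omega
  · rintro ⟨hS, hc⟩
    obtain ⟨a, b, hab, hsub⟩ := (le_card_of_not_preconnected hn hS.1.2 hS.2).2 (by omega)
    -- All neighbourhoods of edges have the minimum size, so the inclusion in `S` is an equality.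
    refine ⟨a, b, hab, (Set.eq_of_subset_of_ncard_le hsub ?_).symm⟩
    have := card_pairNeighborSet hab
    rw [Set.ncard_coe_finset]
    omega
  · rintro ⟨a, b, hab, hS⟩
    have := hpair hab hS
    exact ⟨isSuperVertexCut_of_eq_pairNeighborSet hn hab hS, by omega⟩
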